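/- Let $n\ge 1$, let $r_0>0$, and let $B_{r_0}=\{x\in\mathbb R^n:|x|<r_0\}$. Let $u$ be a real-valued function which is harmonic on $\mathbb R^n\setminus B_{r_0}$, in the sense that $u$ is continuous on $\{|x|\ge r_0\}$, and is $C^2$ with $\Delta u=0$ on the open set $\{|x|>r_0\}$. (In particular this covers functions harmonic in a neighbourhood of $\mathbb R^n\setminus B_{r_0}$.) (1) If $u$ vanishes to infinite order in the $L^2$ sense at infinity, that is, $$\lim_{r\to\infty} r^m\int_{|x|>r}|u|^2\,dx=0\quad\text{for every real } m\ge 0,$$ then $u\equiv 0$ on $\mathbb R^n\setminus B_{r_0}$. (2) Namely, if $u\neq 0$ somewhere on $\mathbb R^n\setminus B_{r_0}$, then there is a real $N\ge 0$ such that $$\limsup_{r\to\infty} r^N\int_{|x|>r}|u|^2\,dx=\infty.$$ Here the integrals are taken in $[0,\infty]$. -/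

import Mathlib

open Filter Topology MeasureTheory Metric InnerProductSpace
open scoped ENNReal

/-- The tail integral `∫_{|x| > r} |u|²` over `ℝⁿ` with Lebesgue measure, as an extended
nonnegative number (it is `∞` when `u` is not square integrable on `{|x| > r}`). -/
noncomputable def tailL2 {n : ℕ} (u : EuclideanSpace ℝ (Fin n) → ℝ) (r : ℝ) : ℝ≥0∞ :=
  ∫⁻ x in {x : EuclideanSpace ℝ (Fin n) | r < ‖x‖}, ENNReal.ofReal (|u x| ^ 2)

/-- `u` vanishes to infinite order in the `L²` sense at infinity: for every real `m ≥ 0`,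
`r ^ m * ∫_{|x| > r} |u|² → 0` as `r → ∞`. -/
def VanishesToInfiniteOrderAtInfinity {n : ℕ} (u : EuclideanSpace ℝ (Fin n) → ℝ) : Prop :=
  ∀ m : ℝ, 0 ≤ m →
    Tendsto (fun r : ℝ => ENNReal.ofReal (r ^ m) * tailL2 u r) atTop (𝓝 0)

/-! Everything rests on one computation. If `p` is homogeneous of degree `k` and `s = ‖x‖²`, Euler's
identity gives Δ(p g(s)) = (Δp) g(s) + p (4 s g''(s) + (4k + 2n) g'(s)). Given a weight `h`
supported in [a, b] with `a > r₀²`, solve 4 s g'' + 4 (k + n/2) g' = h with `g = 0` below `a`. Were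
`g` compactly supported, Green's identity for the harmonic `u` would give ∫ u p h(s) = -∫ u (Δp)
g(s), and the right side would vanish by induction on the degree, since Δp has degree k - 2.

The solution `g` need not vanish near infinity, so it is cut off at a height `T`. Because `g` grows
at most linearly and `g'` is bounded, the cutoff error in the equation is bounded uniformly in `T`
and lives on a far shell. Its pairing with `u p` is at most a power of the radius times the L¹ norm
of `u` on that shell, which tends to 0 by infinite order vanishing. Hence `u h(‖x‖²)` is orthogonal
to every polynomial (`integral_mul_homogeneous_mul_radial_eq_zero`). It is continuous with compact
support, so it vanishes by Stone–Weierstrass; varying `h` gives `u = 0` outside the closed ball, and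
continuity reaches the sphere.

The second claim is the contrapositive, with one extra power of `r` turning failure of convergence
to 0 into unboundedness. -/

/-! ### The radial equation and its truncation. -/

/-- A twice continuously differentiable cutoff, equal to `1` on `(-∞, 1]` and to `0` on
`[2, ∞)`, together with bounds for its first two derivatives. -/
lemma exists_cutoff :
    ∃ χ χ₁ χ₂ : ℝ → ℝ, (∀ s, HasDerivAt χ (χ₁ s) s) ∧ (∀ s, HasDerivAt χ₁ (χ₂ s) s) ∧
      Continuous χ₂ ∧ (∀ s ≤ 1, χ s = 1) ∧ (∀ s, 2 ≤ s → χ s = 0) ∧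
      (∀ s, s ∉ Set.Icc 1 2 → χ₁ s = 0 ∧ χ₂ s = 0) ∧
      ∃ C, 0 ≤ C ∧ ∀ s, |χ₁ s| ≤ C ∧ |χ₂ s| ≤ C := by
  have hsm : ContDiff ℝ 2 (fun s : ℝ => Real.smoothTransition (2 - s)) :=
    (Real.smoothTransition.contDiff (n := 2)).comp (contDiff_const.sub contDiff_id)
  set χ : ℝ → ℝ := fun s => Real.smoothTransition (2 - s) with hχ
  have h1 : ContDiff ℝ 1 (deriv χ) := by
    have := (contDiff_succ_iff_deriv (n := 1) (f := χ)).1 (by simpa [one_add_one_eq_two] using hsm)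
    exact this.2.2
  have h2 : Continuous (deriv (deriv χ)) := h1.continuous_deriv le_rfl
  have hone : ∀ s ≤ 1, χ s = 1 := fun s hs => Real.smoothTransition.one_of_one_le (by linarith)
  have hzero : ∀ s, 2 ≤ s → χ s = 0 := fun s hs =>
    Real.smoothTransition.zero_of_nonpos (by linarith)
  have hloc : ∀ s, s ∉ Set.Icc (1 : ℝ) 2 → deriv χ =ᶠ[𝓝 s] fun _ => 0 := by
    intro s hs
    rw [Set.mem_Icc, not_and_or, not_le, not_le] at hs
    have : ∃ c, χ =ᶠ[𝓝 s] fun _ => c := by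
      rcases hs with hs | hs
      · exact ⟨1, by filter_upwards [Iio_mem_nhds hs] with t ht using hone t (le_of_lt ht)⟩
      · exact ⟨0, by filter_upwards [Ioi_mem_nhds hs] with t ht using hzero t (le_of_lt ht)⟩
    obtain ⟨c, hc⟩ := this
    have := hc.deriv
    simpa using this
  have hout : ∀ s, s ∉ Set.Icc (1 : ℝ) 2 → deriv χ s = 0 ∧ deriv (deriv χ) s = 0 := by
    intro s hs
    refine ⟨(hloc s hs).eq_of_nhds, ?_⟩
    have := (hloc s hs).deriv.eq_of_nhds
    simpa using this
  obtain ⟨C₁, hC₁⟩ := isCompact_Icc.exists_bound_of_continuousOn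
    (s := Set.Icc (1 : ℝ) 2) (h1.continuous.continuousOn)
  obtain ⟨C₂, hC₂⟩ := isCompact_Icc.exists_bound_of_continuousOn
    (s := Set.Icc (1 : ℝ) 2) (h2.continuousOn)
  refine ⟨χ, deriv χ, deriv (deriv χ), fun s => (hsm.differentiable (by simp) s).hasDerivAt,
    fun s => (h1.differentiable (by simp) s).hasDerivAt, h2, hone, hzero, hout,
    max 0 (max C₁ C₂), le_max_left _ _, fun s => ?_⟩
  by_cases hs : s ∈ Set.Icc (1 : ℝ) 2
  · exact ⟨(hC₁ s hs).trans ((le_max_left _ _).trans (le_max_right _ _)),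
      (hC₂ s hs).trans ((le_max_right _ _).trans (le_max_right _ _))⟩
  · simp [hout s hs]

/-- The Euler equation `4 s g'' + 4 α g' = h` has a solution which vanishes to the left of the
support of `h`, has bounded derivative and grows at most linearly. -/
lemma exists_euler_solution {α a b : ℝ} (hα : 0 ≤ α) (ha : 0 < a) {h : ℝ → ℝ}
    (hc : Continuous h) (hs : Function.support h ⊆ Set.Icc a b) :
    ∃ g g₁ g₂ : ℝ → ℝ, (∀ s, HasDerivAt g (g₁ s) s) ∧ (∀ s, HasDerivAt g₁ (g₂ s) s) ∧
      Continuous g₂ ∧ (∀ s < a, g s = 0 ∧ g₁ s = 0 ∧ g₂ s = 0) ∧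
      (∀ s, 4 * s * g₂ s + 4 * α * g₁ s = h s) ∧
      ∃ C, 0 ≤ C ∧ ∀ s, |g₁ s| ≤ C ∧ |g s| ≤ C * |s| := by
  have h0 : ∀ s < a, h s = 0 := fun s hsa => by
    by_contra hne
    exact absurd (hs hne).1 (not_le.2 hsa)
  have h0a : ∀ s ≤ a, h s = 0 := by
    have : IsClosed {s | h s = 0} := isClosed_eq hc continuous_const
    have h2 : closure (Set.Iio a) ⊆ {s | h s = 0} := closure_minimal h0 this
    rw [closure_Iio] at h2
    exact h2
  have hb : ∀ s, b < s → h s = 0 := fun s hsb => by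
    by_contra hne
    exact absurd (hs hne).2 (not_le.2 hsb)
  -- Functions that vanish below `a > 0` do not see the singularity of real powers and of division
  -- at 0.
  have glue : ∀ F : ℝ → ℝ, (∀ s < a, F s = 0) → (∀ s, 0 < s → ContinuousAt F s) →
      Continuous F := by
    intro F hF hF'
    rw [continuous_iff_continuousAt]
    intro s
    rcases lt_or_ge s a with hsa | hsa
    · exact (continuousAt_const (y := (0 : ℝ))).congr
        (by filter_upwards [Iio_mem_nhds hsa] with t ht using (hF t ht).symm)
    · exact hF' s (ha.trans_le hsa)
  -- Integrating factor: for s > 0 the equation reads (s^α g')' = s^(α-1) h / 4.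
  set k : ℝ → ℝ := fun t => t ^ (α - 1) * h t / 4 with hk
  have hkc : Continuous k := by
    refine glue k (fun s hsa => by simp [hk, h0 s hsa]) fun s hs0 => ?_
    exact ((Real.continuousAt_rpow_const s _ (Or.inl hs0.ne')).mul hc.continuousAt).div_const _
  set H : ℝ → ℝ := fun s => ∫ t in a..s, k t with hH
  have hHd : ∀ s, HasDerivAt H (k s) s := fun s => hkc.integral_hasStrictDerivAt a s |>.hasDerivAt
  have hHc : Continuous H := continuous_iff_continuousAt.2 fun s => (hHd s).continuousAt
  have hH0 : ∀ s ≤ a, H s = 0 := by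
    intro s hsa
    refine intervalIntegral.integral_zero_ae (Eventually.of_forall fun t ht => ?_)
    rw [Set.uIoc_of_ge hsa] at ht
    simp [hk, h0a t ht.2]
  have hHb : ∀ s, b ≤ s → H s = H b := by
    intro s hsb
    have e : (∫ t in a..b, k t) + ∫ t in b..s, k t = ∫ t in a..s, k t :=
      intervalIntegral.integral_add_adjacent_intervals (hkc.intervalIntegrable _ _)
        (hkc.intervalIntegrable _ _)
    have z : ∫ t in b..s, k t = 0 := by
      refine intervalIntegral.integral_zero_ae (Eventually.of_forall fun t ht => ?_)
      rw [Set.uIoc_of_le hsb] at ht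
      simp [hk, hb t ht.1]
    simp only [hH]
    rw [← e, z, add_zero]
  -- `H` is 0 before `a` and constant after `b`. With α ≥ 0, so that s^(-α) ≤ a^(-α) for s > a, this
  -- bounds g'.
  obtain ⟨M, hM⟩ : ∃ M, ∀ s, |H s| ≤ M := by
    obtain ⟨M, hM⟩ := isCompact_Icc.exists_bound_of_continuousOn
      (s := Set.Icc a b) hHc.continuousOn
    refine ⟨max (max 0 |H b|) M, fun s => ?_⟩
    rcases le_or_gt s a with h1 | h1
    · simp [hH0 s h1]
    · rcases le_or_gt b s with h2 | h2
      · rw [hHb s h2]; exact (le_max_right _ _).trans (le_max_left _ _)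
      · exact (hM s ⟨h1.le, h2.le⟩).trans (le_max_right _ _)
  set g₁ : ℝ → ℝ := fun s => s ^ (-α) * H s with hg₁
  set g₂ : ℝ → ℝ := fun s => (h s / 4 - α * g₁ s) / s with hg₂
  have hg₁0 : ∀ s ≤ a, g₁ s = 0 := fun s hsa => by simp [hg₁, hH0 s hsa]
  have hg₂0 : ∀ s ≤ a, g₂ s = 0 := fun s hsa => by simp [hg₂, hg₁0 s hsa, h0a s hsa]
  have hd₁ : ∀ s, HasDerivAt g₁ (g₂ s) s := by
    intro s
    rcases lt_or_ge s a with hsa | hsa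
    · rw [hg₂0 s hsa.le]
      exact (hasDerivAt_const s (0 : ℝ)).congr_of_eventuallyEq
        (by filter_upwards [Iio_mem_nhds hsa] with t ht using hg₁0 t (le_of_lt ht))
    · have hs0 : 0 < s := ha.trans_le hsa
      have hd := (Real.hasDerivAt_rpow_const (p := -α) (Or.inl hs0.ne')).mul (hHd s)
      convert! hd using 1
      have e1 : s ^ (-α - 1) = s ^ (-α) / s := Real.rpow_sub_one hs0.ne' _
      have e2 : s ^ (α - 1) = s ^ α / s := Real.rpow_sub_one hs0.ne' _
      have e3 : s ^ (-α) * s ^ α = 1 := by rw [← Real.rpow_add hs0]; simp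
      simp only [hg₂, hg₁, hk, e1, e2]
      have : s ^ (-α) * (s ^ α / s * h s / 4) = (s ^ (-α) * s ^ α) * (h s / 4 / s) := by ring
      rw [this, e3]
      ring
  have hg₁c : Continuous g₁ := continuous_iff_continuousAt.2 fun s => (hd₁ s).continuousAt
  have hg₂c : Continuous g₂ := by
    refine glue g₂ (fun s hsa => hg₂0 s hsa.le) fun s hs0 => ?_
    exact ContinuousAt.div (by fun_prop) continuousAt_id hs0.ne'
  have hM0 : 0 ≤ M := (abs_nonneg _).trans (hM 0)
  set C := a ^ (-α) * M with hC
  have hC0 : 0 ≤ C := mul_nonneg (Real.rpow_nonneg ha.le _) hM0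
  have hg₁C : ∀ s, |g₁ s| ≤ C := by
    intro s
    rcases le_or_gt s a with hsa | hsa
    · simpa [hg₁0 s hsa] using hC0
    · simp only [hg₁, abs_mul]
      rw [abs_of_nonneg (Real.rpow_nonneg (ha.trans hsa).le _)]
      exact mul_le_mul (Real.rpow_le_rpow_of_nonpos ha hsa.le (by linarith)) (hM s)
        (abs_nonneg _) (Real.rpow_nonneg ha.le _)
  set g : ℝ → ℝ := fun s => ∫ t in a..s, g₁ t with hg
  have hg0 : ∀ s ≤ a, g s = 0 := by
    intro s hsa
    refine intervalIntegral.integral_zero_ae (Eventually.of_forall fun t ht => ?_)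
    rw [Set.uIoc_of_ge hsa] at ht
    exact hg₁0 t ht.2
  refine ⟨g, g₁, g₂, fun s => hg₁c.integral_hasStrictDerivAt a s |>.hasDerivAt, hd₁, hg₂c,
    fun s hsa => ⟨hg0 s hsa.le, hg₁0 s hsa.le, hg₂0 s hsa.le⟩, fun s => ?_, C, hC0,
    fun s => ⟨hg₁C s, ?_⟩⟩
  · rcases le_or_gt s a with hsa | hsa
    · simp [hg₁0 s hsa, hg₂0 s hsa, h0a s hsa]
    · have hs0 := (ha.trans hsa).ne'
      simp only [hg₂]
      field_simp
      ring
  · rcases le_or_gt s a with hsa | hsa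
    · rw [hg0 s hsa, abs_zero]; positivity
    · have := intervalIntegral.norm_integral_le_of_norm_le_const (a := a) (b := s) (f := g₁)
        (C := C) (fun t _ => hg₁C t)
      refine this.trans (mul_le_mul_of_nonneg_left ?_ hC0)
      rw [abs_of_pos (by linarith), abs_of_pos (by linarith)]
      linarith

/-- Truncating a solution of the Euler equation at height `T` gives a compactly supported function
solving the equation up to an error bounded uniformly in `T` and supported in `[T, 2T]`. -/
lemma exists_truncated_euler_solution {α a b : ℝ} (hα : 0 ≤ α) (ha : 0 < a) {h : ℝ → ℝ}
    (hc : Continuous h) (hs : Function.support h ⊆ Set.Icc a b) :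
    ∃ A, 0 ≤ A ∧ ∀ T, 0 < T → b ≤ T → ∃ g g₁ g₂ e : ℝ → ℝ,
      (∀ s, HasDerivAt g (g₁ s) s) ∧ (∀ s, HasDerivAt g₁ (g₂ s) s) ∧ Continuous g₂ ∧
      (∀ s, s ∉ Set.Icc a (2 * T) → g s = 0 ∧ g₁ s = 0 ∧ g₂ s = 0) ∧
      (∀ s, 4 * s * g₂ s + 4 * α * g₁ s = h s + e s) ∧
      (∀ s, |e s| ≤ A) ∧ Function.support e ⊆ Set.Icc T (2 * T) := by
  obtain ⟨χ, χ₁, χ₂, hχ, hχ₁, hχ₂, hone, hzero, hout, C, hC0, hC⟩ := exists_cutoff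
  obtain ⟨g, g₁, g₂, hg, hg₁, hg₂, hga, heq, D, hD0, hD⟩ := exists_euler_solution hα ha hc hs
  -- The sum of the bounds 16, 16 and 8α (times `D * C`) for the three error terms. On [T, 2T] each
  -- 1/T from the cutoff is absorbed by a factor `s` or by `g`, which is why no `T` remains.
  refine ⟨(32 + 8 * α) * (D * C), by positivity, fun T hT hbT => ?_⟩
  have hdiv : ∀ s, HasDerivAt (fun s => s / T) (1 / T) s := fun s => (hasDerivAt_id s).div_const T
  have hχT : ∀ s, HasDerivAt (fun s => χ (s / T)) (χ₁ (s / T) * (1 / T)) s := fun s =>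
    (hχ (s / T)).comp s (hdiv s)
  have hχT₁ : ∀ s, HasDerivAt (fun s => χ₁ (s / T)) (χ₂ (s / T) * (1 / T)) s := fun s =>
    (hχ₁ (s / T)).comp s (hdiv s)
  have houtT : ∀ s, s ∉ Set.Icc T (2 * T) → χ₁ (s / T) = 0 ∧ χ₂ (s / T) = 0 := by
    intro s hsT
    refine hout _ fun hm => hsT ⟨?_, ?_⟩
    · have := (le_div_iff₀ hT).1 hm.1; linarith
    · exact (div_le_iff₀ hT).1 hm.2
  have hc₀ : Continuous g := continuous_iff_continuousAt.2 fun s => (hg s).continuousAt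
  have hc₁ : Continuous g₁ := continuous_iff_continuousAt.2 fun s => (hg₁ s).continuousAt
  have hcχ : Continuous χ := continuous_iff_continuousAt.2 fun s => (hχ s).continuousAt
  have hcχ₁ : Continuous χ₁ := continuous_iff_continuousAt.2 fun s => (hχ₁ s).continuousAt
  refine ⟨fun s => g s * χ (s / T), fun s => g₁ s * χ (s / T) + g s * (χ₁ (s / T) * (1 / T)),
    fun s => (g₂ s * χ (s / T) + g₁ s * (χ₁ (s / T) * (1 / T))) +
      (g₁ s * (χ₁ (s / T) * (1 / T)) + g s * (χ₂ (s / T) * (1 / T) * (1 / T))),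
    -- The error collects the terms in which a derivative falls on the cutoff.
    fun s => 4 * s * (2 * g₁ s * (χ₁ (s / T) * (1 / T)) + g s * (χ₂ (s / T) * (1 / T) * (1 / T)))
      + 4 * α * (g s * (χ₁ (s / T) * (1 / T))), fun s => (hg s).mul (hχT s),
    fun s => ((hg₁ s).mul (hχT s)).add ((hg s).mul ((hχT₁ s).mul_const _)), by fun_prop,
    ?_, fun s => ?_, fun s => ?_, ?_⟩
  · intro s hsm
    rw [Set.mem_Icc, not_and_or, not_le, not_le] at hsm
    rcases hsm with hsm | hsm
    · simp [hga s hsm]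
    · have h1 := houtT s fun hm => absurd hm.2 (not_le.2 hsm)
      have h2 := hzero (s / T) (by rw [le_div_iff₀ hT]; exact hsm.le)
      simp [h1, h2]
  -- `h` vanishes beyond `b ≤ T`, where alone the cutoff differs from 1.
  · have hh : h s * χ (s / T) = h s := by
      rcases le_or_gt s b with hsb | hsb
      · rw [hone _ (by rw [div_le_one hT]; linarith), mul_one]
      · have : h s = 0 := by
          by_contra hne
          exact absurd (hs hne).2 (not_le.2 hsb)
        simp [this]
    rw [← hh, ← heq s]
    ring
  · by_cases hsT : s ∈ Set.Icc T (2 * T)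
    · have hs0 : 0 < s := hT.trans_le hsT.1
      have hsT2 : s / T ≤ 2 := (div_le_iff₀ hT).2 hsT.2
      have hsT0 : 0 ≤ s / T := by positivity
      obtain ⟨d1, d2⟩ := hD s
      obtain ⟨c1, c2⟩ := hC (s / T)
      rw [abs_of_pos hs0] at d2
      set q := s / T with hq
      have e : 4 * s * (2 * g₁ s * (χ₁ q * (1 / T)) + g s * (χ₂ q * (1 / T) * (1 / T)))
          + 4 * α * (g s * (χ₁ q * (1 / T))) =
          8 * q * (g₁ s * χ₁ q) + 4 * q * ((g s / T) * χ₂ q) + 4 * α * ((g s / T) * χ₁ q) := by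
        rw [hq]; ring
      have d3 : |g s / T| ≤ D * 2 := by
        rw [abs_div, abs_of_pos hT]
        calc |g s| / T ≤ D * s / T := by gcongr
          _ = D * q := by rw [hq]; ring
          _ ≤ D * 2 := by gcongr
      beta_reduce
      rw [← hq, e]
      have b1 : |8 * q * (g₁ s * χ₁ q)| ≤ 16 * (D * C) := by
        rw [abs_mul, abs_mul (g₁ s), abs_of_nonneg (by positivity : 0 ≤ 8 * q)]
        exact mul_le_mul (by linarith) (by gcongr) (by positivity) (by norm_num)
      have b2 : |4 * q * ((g s / T) * χ₂ q)| ≤ 8 * (D * 2 * C) := by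
        rw [abs_mul, abs_mul (g s / T), abs_of_nonneg (by positivity : 0 ≤ 4 * q)]
        exact mul_le_mul (by linarith) (by gcongr) (by positivity) (by norm_num)
      have b3 : |4 * α * ((g s / T) * χ₁ q)| ≤ 4 * α * (D * 2 * C) := by
        rw [abs_mul, abs_mul (g s / T), abs_of_nonneg (by positivity : 0 ≤ 4 * α)]
        gcongr
      calc _ ≤ 16 * (D * C) + 8 * (D * 2 * C) + 4 * α * (D * 2 * C) :=
            (abs_add_le _ _).trans (add_le_add ((abs_add_le _ _).trans (add_le_add b1 b2)) b3)
        _ = _ := by ring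
    · simp only [houtT s hsT]
      simp only [zero_mul, mul_zero, add_zero, abs_zero]
      positivity
  · intro s hne
    by_contra hsT
    exact hne (by simp [houtT s hsT])

/-! ### Green's identity on annuli. -/

section Annulus

variable {n : ℕ} {r₀ a b : ℝ}

lemma lt_norm_of_le_sq {E : Type*} [NormedAddCommGroup E] (ha : r₀ ^ 2 < a) {x : E}
    (hx : a ≤ ‖x‖ ^ 2) : r₀ < ‖x‖ :=
  lt_of_pow_lt_pow_left₀ 2 (norm_nonneg x) (ha.trans_le hx)

/-- Since `r₀² < a`, the zero region ‖x‖² < a and the domain of continuity are open sets covering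
the space. This makes products of `u` with test functions global, whatever `u` does inside the ball.
-/
lemma continuous_of_annulus {f : EuclideanSpace ℝ (Fin n) → ℝ} (ha : r₀ ^ 2 < a)
    (hf : ContinuousOn f {x | r₀ < ‖x‖}) (hs : ∀ x, ‖x‖ ^ 2 ∉ Set.Icc a b → f x = 0) :
    Continuous f := by
  have hU : IsOpen {x : EuclideanSpace ℝ (Fin n) | r₀ < ‖x‖} :=
    isOpen_lt continuous_const continuous_norm
  rw [continuous_iff_continuousAt]
  intro x
  rcases lt_or_ge (‖x‖ ^ 2) a with hx | hx
  · have : IsOpen {x : EuclideanSpace ℝ (Fin n) | ‖x‖ ^ 2 < a} :=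
      isOpen_lt (by fun_prop) continuous_const
    refine (continuousAt_const (y := (0 : ℝ))).congr ?_
    filter_upwards [this.mem_nhds hx] with y hy
    exact (hs y fun h => absurd h.1 (not_le.2 hy)).symm
  · exact hf.continuousAt (hU.mem_nhds (lt_norm_of_le_sq ha hx))

lemma hasCompactSupport_of_annulus {f : EuclideanSpace ℝ (Fin n) → ℝ}
    (hs : ∀ x, ‖x‖ ^ 2 ∉ Set.Icc a b → f x = 0) : HasCompactSupport f := by
  refine HasCompactSupport.intro (isCompact_closedBall 0 (max b 1)) fun x hx => hs x fun h => hx ?_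
  rw [mem_closedBall_zero_iff]
  by_contra! hlt
  have h1 := (le_max_left b 1).trans_lt hlt
  have h2 := (le_max_right b 1).trans_lt hlt
  nlinarith [h.2]

lemma integrable_of_annulus {f : EuclideanSpace ℝ (Fin n) → ℝ} (ha : r₀ ^ 2 < a)
    (hf : ContinuousOn f {x | r₀ < ‖x‖}) (hs : ∀ x, ‖x‖ ^ 2 ∉ Set.Icc a b → f x = 0) :
    Integrable f :=
  (continuous_of_annulus ha hf hs).integrable_of_hasCompactSupport (hasCompactSupport_of_annulus hs)

lemma HasLineDerivAt.mul_real {E : Type*} [AddCommGroup E] [Module ℝ E] {f g : E → ℝ}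
    {f' g' : ℝ} {x v : E} (hf : HasLineDerivAt ℝ f f' x v) (hg : HasLineDerivAt ℝ g g' x v) :
    HasLineDerivAt ℝ (fun y => f y * g y) (f' * g x + f x * g') x v := by
  have := HasDerivAt.mul (𝕜 := ℝ) hf hg
  simp only [zero_smul, add_zero] at this
  exact this

lemma HasLineDerivAt.sub_real {E : Type*} [AddCommGroup E] [Module ℝ E] {f g : E → ℝ}
    {f' g' : ℝ} {x v : E} (hf : HasLineDerivAt ℝ f f' x v) (hg : HasLineDerivAt ℝ g g' x v) :
    HasLineDerivAt ℝ (fun y => f y - g y) (f' - g') x v :=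
  HasDerivAt.sub (𝕜 := ℝ) hf hg

/-- Integration by parts against the constant function 1. -/
lemma integral_hasLineDerivAt_eq_zero {F F' : EuclideanSpace ℝ (Fin n) → ℝ}
    {v : EuclideanSpace ℝ (Fin n)} (hF : Integrable F) (hF' : Integrable F')
    (h : ∀ x, HasLineDerivAt ℝ F (F' x) x v) : ∫ x, F' x = 0 := by
  have := integral_bilinear_hasLineDerivAt_right_eq_neg_left_of_integrable
    (μ := (volume : Measure (EuclideanSpace ℝ (Fin n))))
    (f := fun _ => (1 : ℝ)) (f' := fun _ => 0) (g := F) (g' := F') (v := v)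
    (B := ContinuousLinearMap.mul ℝ ℝ) (by simp) (by simpa using hF')
    (by simpa using hF) (fun x _ => hasDerivAt_const (0 : ℝ) (1 : ℝ)) (fun x _ => h x)
  simpa using this

/-- A harmonic function is orthogonal to the Laplacian of a test function supported in its
domain. -/
theorem integral_mul_laplacian_eq_zero {u ψ : EuclideanSpace ℝ (Fin n) → ℝ}
    {ψ₁ ψ₂ : Fin n → EuclideanSpace ℝ (Fin n) → ℝ} (ha : r₀ ^ 2 < a)
    (hu : HarmonicOnNhd u {x | r₀ < ‖x‖}) (hψ : Continuous ψ) (hψ₁ : ∀ i, Continuous (ψ₁ i))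
    (hψ₂ : ∀ i, Continuous (ψ₂ i))
    (hd : ∀ i x, HasLineDerivAt ℝ ψ (ψ₁ i x) x (EuclideanSpace.single i 1))
    (hd₁ : ∀ i x, HasLineDerivAt ℝ (ψ₁ i) (ψ₂ i x) x (EuclideanSpace.single i 1))
    (hs : ∀ x, ‖x‖ ^ 2 ∉ Set.Icc a b → ψ x = 0 ∧ ∀ i, ψ₁ i x = 0 ∧ ψ₂ i x = 0) :
    ∫ x, u x * ∑ i, ψ₂ i x = 0 := by
  set U : Set (EuclideanSpace ℝ (Fin n)) := {x | r₀ < ‖x‖} with hUdef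
  have hU : IsOpen U := isOpen_lt continuous_const continuous_norm
  have hC : ContDiffOn ℝ 2 u U := hu.contDiffOn
  have hC₁ : ContDiffOn ℝ 1 (fderiv ℝ u) U := hC.fderiv_of_isOpen hU (by norm_num)
  have hC₂ : ContinuousOn (fderiv ℝ (fderiv ℝ u)) U :=
    (hC₁.fderiv_of_isOpen (m := 0) hU (by norm_num)).continuousOn
  set e : Fin n → EuclideanSpace ℝ (Fin n) := fun i => EuclideanSpace.single i 1 with he
  set u₁ : Fin n → EuclideanSpace ℝ (Fin n) → ℝ := fun i x => fderiv ℝ u x (e i) with hu₁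
  set u₂ : Fin n → EuclideanSpace ℝ (Fin n) → ℝ :=
    fun i x => fderiv ℝ (fderiv ℝ u) x (e i) (e i) with hu₂
  have hu0c : ContinuousOn u U := hC.continuousOn
  have hu₁c : ∀ i, ContinuousOn (u₁ i) U := fun i => hC₁.continuousOn.clm_apply continuousOn_const
  have hu₂c : ∀ i, ContinuousOn (u₂ i) U := fun i =>
    (hC₂.clm_apply continuousOn_const).clm_apply continuousOn_const
  have hud : ∀ i, ∀ x ∈ U, HasLineDerivAt ℝ u (u₁ i x) x (e i) := fun i x hx =>
    ((hC.contDiffAt (hU.mem_nhds hx)).differentiableAt (by norm_num)).hasFDerivAt.hasLineDerivAt _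
  have hud₁ : ∀ i, ∀ x ∈ U, HasLineDerivAt ℝ (u₁ i) (u₂ i x) x (e i) := fun i x hx => by
    have h1 := ((hC₁.contDiffAt (hU.mem_nhds hx)).differentiableAt (by norm_num)).hasFDerivAt
    have h2 := h1.clm_apply (hasFDerivAt_const (e i) x)
    simpa [hu₂] using h2.hasLineDerivAt (e i)
  have hlap : ∀ x ∈ U, ∑ i, u₂ i x = 0 := by
    intro x hx
    have h1 := (hu x hx).2.eq_of_nhds
    rw [laplacian_eq_iteratedFDeriv_orthonormalBasis u (EuclideanSpace.basisFun (Fin n) ℝ)] at h1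
    simpa [iteratedFDeriv_two_apply] using h1
  have hint : ∀ i, Integrable (fun x => u x * ψ₂ i x - u₂ i x * ψ x) := fun i =>
    integrable_of_annulus (b := b) ha ((hu0c.mul (hψ₂ i).continuousOn).sub
      ((hu₂c i).mul hψ.continuousOn)) fun x hx => by simp [hs x hx]
  have hzero : ∀ i, ∫ x, (u x * ψ₂ i x - u₂ i x * ψ x) = 0 := by
    intro i
    have hvan : ∀ x, ‖x‖ ^ 2 ∉ Set.Icc a b → u x * ψ₁ i x - u₁ i x * ψ x = 0 :=
      fun x hx => by simp [hs x hx]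
    -- Both second-order terms come from the single field `u ∂ᵢψ - (∂ᵢu) ψ`: the first-order
    -- products cancel in its derivative.
    refine integral_hasLineDerivAt_eq_zero (F := fun x => u x * ψ₁ i x - u₁ i x * ψ x)
      (v := e i) ?_ (hint i) fun x => ?_
    · exact integrable_of_annulus ha ((hu0c.mul (hψ₁ i).continuousOn).sub
        ((hu₁c i).mul hψ.continuousOn)) hvan
    · rcases lt_or_ge (‖x‖ ^ 2) a with hx | hx
      · have hop : IsOpen {x : EuclideanSpace ℝ (Fin n) | ‖x‖ ^ 2 < a} :=
          isOpen_lt (by fun_prop) continuous_const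
        have hx' := hs x fun h => absurd h.1 (not_le.2 hx)
        have h0 : HasLineDerivAt ℝ (fun _ : EuclideanSpace ℝ (Fin n) => (0 : ℝ)) 0 x (e i) :=
          hasDerivAt_const (0 : ℝ) (0 : ℝ)
        have h1 : u x * ψ₂ i x - u₂ i x * ψ x = 0 := by simp [hx']
        rw [h1]
        refine h0.congr_of_eventuallyEq ?_
        filter_upwards [hop.mem_nhds hx] with y hy
        exact hvan y fun h => absurd h.1 (not_le.2 hy)
      · have hxU : x ∈ U := lt_norm_of_le_sq ha hx
        convert! ((hud i x hxU).mul_real (hd₁ i x)).sub_real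
          ((hud₁ i x hxU).mul_real (hd i x)) using 1
        ring
  have hsum : ∫ x, ∑ i, (u x * ψ₂ i x - u₂ i x * ψ x) = 0 := by
    rw [integral_finsetSum _ fun i _ => hint i]
    exact Finset.sum_eq_zero fun i _ => hzero i
  rw [← hsum]
  congr 1 with x
  rw [Finset.sum_sub_distrib, ← Finset.mul_sum, ← Finset.sum_mul]
  by_cases hx : ‖x‖ ^ 2 ∈ Set.Icc a b
  · rw [hlap x (lt_norm_of_le_sq ha hx.1)]; ring
  · rw [(hs x hx).1]; ring

end Annulus

/-! ### Derivatives and growth of polynomials and radial functions. -/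

section Polynomial

variable {n : ℕ}

lemma continuous_eval_euclidean (p : MvPolynomial (Fin n) ℝ) :
    Continuous fun x : EuclideanSpace ℝ (Fin n) => MvPolynomial.eval x.ofLp p :=
  (MvPolynomial.continuous_eval p).comp (PiLp.continuous_ofLp 2 _)

lemma hasLineDerivAt_coord (x : EuclideanSpace ℝ (Fin n)) (i j : Fin n) :
    HasLineDerivAt ℝ (fun y : EuclideanSpace ℝ (Fin n) => y.ofLp j)
      ((EuclideanSpace.single i (1 : ℝ) : EuclideanSpace ℝ (Fin n)).ofLp j) x
      (EuclideanSpace.single i 1) :=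
  (EuclideanSpace.proj j : EuclideanSpace ℝ (Fin n) →L[ℝ] ℝ).hasFDerivAt.hasLineDerivAt _

lemma HasLineDerivAt.add_real {E : Type*} [AddCommGroup E] [Module ℝ E] {f g : E → ℝ}
    {f' g' : ℝ} {x v : E} (hf : HasLineDerivAt ℝ f f' x v) (hg : HasLineDerivAt ℝ g g' x v) :
    HasLineDerivAt ℝ (fun y => f y + g y) (f' + g') x v :=
  HasDerivAt.add (𝕜 := ℝ) hf hg

lemma hasLineDerivAt_eval (p : MvPolynomial (Fin n) ℝ) (x : EuclideanSpace ℝ (Fin n))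
    (i : Fin n) :
    HasLineDerivAt ℝ (fun y : EuclideanSpace ℝ (Fin n) => MvPolynomial.eval y.ofLp p)
      (MvPolynomial.eval x.ofLp (MvPolynomial.pderiv i p)) x (EuclideanSpace.single i 1) := by
  induction p using MvPolynomial.induction_on with
  | C c => simpa [HasLineDerivAt] using (hasDerivAt_const (0 : ℝ) c)
  | add p q hp hq => simpa using hp.add_real hq
  | mul_X p j hp =>
    convert! hp.mul_real (hasLineDerivAt_coord x i j) using 1
    · simp
    · by_cases hij : j = i
      · subst hij; simp [MvPolynomial.pderiv_X]; ring
      · simp [MvPolynomial.pderiv_X, hij]; ring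

lemma hasLineDerivAt_comp_norm_sq {g g' : ℝ → ℝ} (hg : ∀ s, HasDerivAt g (g' s) s)
    (x : EuclideanSpace ℝ (Fin n)) (i : Fin n) :
    HasLineDerivAt ℝ (fun y : EuclideanSpace ℝ (Fin n) => g (‖y‖ ^ 2))
      (g' (‖x‖ ^ 2) * (2 * x.ofLp i)) x (EuclideanSpace.single i 1) := by
  have h1 := (hasStrictFDerivAt_norm_sq x).hasFDerivAt
  have h2 := ((hg (‖x‖ ^ 2)).comp_hasFDerivAt x h1).hasLineDerivAt (EuclideanSpace.single i 1)
  convert! h2 using 1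
  have := EuclideanSpace.inner_basisFun_real (Fin n) x i
  rw [EuclideanSpace.basisFun_apply] at this
  simp [this]

lemma exists_eval_le (p : MvPolynomial (Fin n) ℝ) :
    ∃ B, 0 ≤ B ∧ ∃ m : ℕ, ∀ x : EuclideanSpace ℝ (Fin n),
      |MvPolynomial.eval x.ofLp p| ≤ B * (1 + ‖x‖) ^ m := by
  induction p using MvPolynomial.induction_on with
  | C c => exact ⟨|c|, abs_nonneg c, 0, fun x => by simp⟩
  | add p q hp hq =>
    obtain ⟨B, hB, m, h⟩ := hp
    obtain ⟨B', hB', m', h'⟩ := hq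
    refine ⟨B + B', by positivity, max m m', fun x => ?_⟩
    have h1 : (1 : ℝ) ≤ 1 + ‖x‖ := by linarith [norm_nonneg x]
    rw [map_add, add_mul]
    refine (abs_add_le _ _).trans (add_le_add ((h x).trans ?_) ((h' x).trans ?_))
    · exact mul_le_mul_of_nonneg_left (pow_le_pow_right₀ h1 (le_max_left _ _)) hB
    · exact mul_le_mul_of_nonneg_left (pow_le_pow_right₀ h1 (le_max_right _ _)) hB'
  | mul_X p j hp =>
    obtain ⟨B, hB, m, h⟩ := hp
    refine ⟨B, hB, m + 1, fun x => ?_⟩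
    have h2 : |x.ofLp j| ≤ 1 + ‖x‖ := by
      have := PiLp.norm_apply_le x j
      rw [Real.norm_eq_abs] at this
      linarith
    rw [map_mul, MvPolynomial.eval_X, abs_mul, pow_succ, ← mul_assoc]
    have := norm_nonneg x
    exact mul_le_mul (h x) h2 (abs_nonneg _) (by positivity)

end Polynomial

/-! ### Orthogonality to homogeneous polynomials with radial weights. -/

section Orthogonality

variable {n : ℕ}

/-- A function vanishing to infinite order at infinity has small mean, to every polynomial order,
over the shells `2 r ≤ ‖x‖ ≤ 3 r`. -/
lemma VanishesToInfiniteOrderAtInfinity.tendsto_shell {u : EuclideanSpace ℝ (Fin n) → ℝ}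
    (hV : VanishesToInfiniteOrderAtInfinity u) (m : ℕ) :
    Tendsto (fun r : ℝ => ENNReal.ofReal (r ^ m) *
      ∫⁻ x in {x : EuclideanSpace ℝ (Fin n) | 2 * r ≤ ‖x‖ ∧ ‖x‖ ≤ 3 * r},
        ENNReal.ofReal |u x|) atTop (𝓝 0) := by
  -- The exponent comes from r^m |u| ≤ r^(2m+n+1) |u|² + r^(-(n+1)), a weighted AM–GM. The shell has
  -- volume O(r^n), so the last term contributes O(1/r).
  have h1 : Tendsto (fun r : ℝ => ENNReal.ofReal (r ^ (2 * m + n + 1)) * tailL2 u r)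
      atTop (𝓝 0) := by
    have := hV ((2 * m + n + 1 : ℕ) : ℝ) (by positivity)
    simpa only [Real.rpow_natCast] using this
  set c := (volume : Measure (EuclideanSpace ℝ (Fin n))) (ball 0 1) with hc
  have h2 : Tendsto (fun r : ℝ => ENNReal.ofReal (3 ^ n * r⁻¹) * c) atTop (𝓝 0) := by
    have hr : Tendsto (fun r : ℝ => (3 : ℝ) ^ n * r⁻¹) atTop (𝓝 0) := by
      simpa using tendsto_inv_atTop_zero.const_mul ((3 : ℝ) ^ n)
    have := ENNReal.Tendsto.mul_const (b := c) (ENNReal.tendsto_ofReal hr)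
      (Or.inr measure_ball_lt_top.ne)
    simpa using this
  have h3 := h1.add h2
  rw [add_zero] at h3
  refine tendsto_of_tendsto_of_tendsto_of_le_of_le' tendsto_const_nhds h3
    (Eventually.of_forall fun _ => zero_le) ?_
  filter_upwards [eventually_gt_atTop 0] with r hr
  set S := {x : EuclideanSpace ℝ (Fin n) | 2 * r ≤ ‖x‖ ∧ ‖x‖ ≤ 3 * r} with hS
  have hpt : ∀ x, ENNReal.ofReal (r ^ m) * ENNReal.ofReal |u x| ≤
      ENNReal.ofReal (r ^ (2 * m + n + 1)) * ENNReal.ofReal (|u x| ^ 2) +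
        ENNReal.ofReal ((r ^ (n + 1))⁻¹) := by
    intro x
    rw [← ENNReal.ofReal_mul (by positivity), ← ENNReal.ofReal_mul (by positivity),
      ← ENNReal.ofReal_add (by positivity) (by positivity)]
    refine ENNReal.ofReal_le_ofReal ?_
    set y := r ^ (n + 1) with hy
    have hy0 : 0 < y := by positivity
    set t := r ^ m * |u x| with ht
    have e : r ^ (2 * m + n + 1) * |u x| ^ 2 = y * t ^ 2 := by
      rw [ht, hy]; ring
    rw [e]
    have e2 : y * t ^ 2 + y⁻¹ - t = y⁻¹ * ((y * t - 1 / 2) ^ 2 + 3 / 4) := by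
      field_simp
      ring
    have : 0 ≤ y * t ^ 2 + y⁻¹ - t := by rw [e2]; positivity
    linarith
  calc ENNReal.ofReal (r ^ m) * ∫⁻ x in S, ENNReal.ofReal |u x|
      = ∫⁻ x in S, ENNReal.ofReal (r ^ m) * ENNReal.ofReal |u x| :=
        (lintegral_const_mul' _ _ ENNReal.ofReal_ne_top).symm
    _ ≤ ∫⁻ x in S, (ENNReal.ofReal (r ^ (2 * m + n + 1)) * ENNReal.ofReal (|u x| ^ 2) +
        ENNReal.ofReal ((r ^ (n + 1))⁻¹)) := lintegral_mono fun x => hpt x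
    _ = ENNReal.ofReal (r ^ (2 * m + n + 1)) * (∫⁻ x in S, ENNReal.ofReal (|u x| ^ 2)) +
        ENNReal.ofReal ((r ^ (n + 1))⁻¹) * volume S := by
        rw [lintegral_add_right _ measurable_const,
          lintegral_const_mul' _ _ ENNReal.ofReal_ne_top, setLIntegral_const]
    _ ≤ _ := by
        gcongr ?_ + ?_
        · gcongr
          exact lintegral_mono_set fun x hx => by
            have : 2 * r ≤ ‖x‖ := hx.1
            exact lt_of_lt_of_le (by linarith) this
        · have hle : volume S ≤ volume (closedBall (0 : EuclideanSpace ℝ (Fin n)) (3 * r)) :=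
            measure_mono fun x hx => by simpa using hx.2
          refine (mul_le_mul_right hle _).trans ?_
          rw [Measure.addHaar_closedBall _ _ (by positivity : 0 ≤ 3 * r), ← mul_assoc,
            ← ENNReal.ofReal_mul (by positivity), finrank_euclideanSpace_fin]
          refine le_of_eq ?_
          congr 2
          field_simp
          ring

/-- If `u` is harmonic outside a ball and vanishes to infinite order at infinity, then `u` is
orthogonal to the product of any homogeneous polynomial and any radial weight with compact support
in the domain. -/
theorem integral_mul_homogeneous_mul_radial_eq_zero {r₀ a : ℝ} (hr₀ : 0 < r₀) (ha : r₀ ^ 2 < a)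
    {u : EuclideanSpace ℝ (Fin n) → ℝ} (hu : HarmonicOnNhd u {x | r₀ < ‖x‖})
    (hV : VanishesToInfiniteOrderAtInfinity u) (k : ℕ) :
    ∀ (p : MvPolynomial (Fin n) ℝ), p.IsHomogeneous k → ∀ (b : ℝ) (h : ℝ → ℝ), Continuous h →
      Function.support h ⊆ Set.Icc a b →
      ∫ x, u x * (MvPolynomial.eval x.ofLp p * h (‖x‖ ^ 2)) = 0 := by
  -- The hypothesis must cover every `b` and `h`: the weight met in lower degree is the truncated
  -- `g`, whose support grows with the radius.
  induction k using Nat.strong_induction_on with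
  | _ k ih =>
  intro p hp b h hc hs
  have ha0 : 0 < a := lt_trans (by positivity) ha
  have hucont : ContinuousOn u {x | r₀ < ‖x‖} := hu.contDiffOn.continuousOn
  have hnsq : Continuous fun x : EuclideanSpace ℝ (Fin n) => ‖x‖ ^ 2 := by fun_prop
  have hdeg : ∀ (g : ℝ → ℝ) (b : ℝ), Continuous g → Function.support g ⊆ Set.Icc a b → ∀ i,
      ∫ x, u x * (MvPolynomial.eval x.ofLp (MvPolynomial.pderiv i (MvPolynomial.pderiv i p)) *
        g (‖x‖ ^ 2)) = 0 := by
    intro g b hg hgs i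
    -- Truncated subtraction gives no smaller degree when k = 0; there `p` is constant. For k = 1
    -- the second derivative counts as homogeneous of degree 0.
    rcases Nat.eq_zero_or_pos k with hk | hk
    · subst hk
      have : p = MvPolynomial.C (p.coeff 0) :=
        MvPolynomial.totalDegree_eq_zero_iff_eq_C.1
          ((MvPolynomial.totalDegree_zero_iff_isHomogeneous _).2 hp)
      rw [this]
      simp
    · exact ih (k - 1 - 1) (by omega) _ hp.pderiv.pderiv b g hg hgs
  have hint : ∀ (q : MvPolynomial (Fin n) ℝ) (g : ℝ → ℝ) (b : ℝ), Continuous g →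
      (∀ s, s ∉ Set.Icc a b → g s = 0) →
      Integrable fun x => u x * (MvPolynomial.eval x.ofLp q * g (‖x‖ ^ 2)) := by
    intro q g b hg hgs
    exact integrable_of_annulus (b := b) ha (hucont.mul ((continuous_eval_euclidean q).mul
      (hg.comp hnsq)).continuousOn) fun x hx => by simp [hgs _ hx]
  have hvan : ∀ {g : ℝ → ℝ} {a b : ℝ}, Function.support g ⊆ Set.Icc a b →
      ∀ s, s ∉ Set.Icc a b → g s = 0 := fun hg s hsn => by
    by_contra hne
    exact hsn (hg hne)
  obtain ⟨A, hA0, hA⟩ := exists_truncated_euler_solution (α := k + n / 2) (by positivity) ha0 hc hs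
  obtain ⟨B, hB0, m, hB⟩ := exists_eval_le p
  have key : ∀ r : ℝ, 1 ≤ r → a ≤ r → b ≤ r →
      ‖∫ x, u x * (MvPolynomial.eval x.ofLp p * h (‖x‖ ^ 2))‖ₑ ≤
        ENNReal.ofReal (A * B * 4 ^ m) * (ENNReal.ofReal (r ^ m) *
          ∫⁻ x in {x : EuclideanSpace ℝ (Fin n) | 2 * r ≤ ‖x‖ ∧ ‖x‖ ≤ 3 * r},
            ENNReal.ofReal |u x|) := by
    intro r hr har hbr
    have hrT : r ≤ 4 * r ^ 2 := by nlinarith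
    -- With T = 4r², the error lives on 4r² ≤ ‖x‖² ≤ 8r², inside the shell 2r ≤ ‖x‖ ≤ 3r.
    obtain ⟨g, g₁, g₂, e, hg, hg₁, hg₂c, hgs, heq, heA, hes⟩ :=
      hA (4 * r ^ 2) (by positivity) (hbr.trans hrT)
    have hgc : Continuous g := continuous_iff_continuousAt.2 fun s => (hg s).continuousAt
    have hg₁c : Continuous g₁ := continuous_iff_continuousAt.2 fun s => (hg₁ s).continuousAt
    have hec : Continuous e := by
      have : e = fun s => 4 * s * g₂ s + 4 * (k + n / 2) * g₁ s - h s := by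
        funext s; rw [heq s]; ring
      rw [this]; fun_prop
    have hes' : ∀ s, s ∉ Set.Icc a (2 * (4 * r ^ 2)) → e s = 0 := fun s hsn =>
      hvan hes s fun hm => hsn ⟨(har.trans hrT).trans hm.1, hm.2⟩
    have hci : ∀ i, Continuous fun x : EuclideanSpace ℝ (Fin n) => x.ofLp i := fun i => by fun_prop
    have hP := continuous_eval_euclidean p
    have hP₁ := fun i => continuous_eval_euclidean (MvPolynomial.pderiv i p)
    have hP₂ := fun i => continuous_eval_euclidean (MvPolynomial.pderiv i (MvPolynomial.pderiv i p))
    have hgn := hgc.comp hnsq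
    have hg₁n := hg₁c.comp hnsq
    have hg₂n := hg₂c.comp hnsq
    simp only [Function.comp_def] at hgn hg₁n hg₂n
    have green := integral_mul_laplacian_eq_zero (b := 2 * (4 * r ^ 2)) ha hu
      (ψ := fun x => MvPolynomial.eval x.ofLp p * g (‖x‖ ^ 2))
      (ψ₁ := fun i x => MvPolynomial.eval x.ofLp (MvPolynomial.pderiv i p) * g (‖x‖ ^ 2) +
        MvPolynomial.eval x.ofLp p * (g₁ (‖x‖ ^ 2) * (2 * x.ofLp i)))
      (ψ₂ := fun i x =>
        (MvPolynomial.eval x.ofLp (MvPolynomial.pderiv i (MvPolynomial.pderiv i p)) * g (‖x‖ ^ 2) +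
          MvPolynomial.eval x.ofLp (MvPolynomial.pderiv i p) * (g₁ (‖x‖ ^ 2) * (2 * x.ofLp i))) +
        (MvPolynomial.eval x.ofLp (MvPolynomial.pderiv i p) * (g₁ (‖x‖ ^ 2) * (2 * x.ofLp i)) +
          MvPolynomial.eval x.ofLp p * (g₂ (‖x‖ ^ 2) * (2 * x.ofLp i) * (2 * x.ofLp i) +
            g₁ (‖x‖ ^ 2) * (0 * x.ofLp i + 2 * 1))))
      (hP.mul hgn)
      (fun i => ((hP₁ i).mul hgn).add (hP.mul (hg₁n.mul ((hci i).const_mul 2))))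
      (fun i => (((hP₂ i).mul hgn).add ((hP₁ i).mul (hg₁n.mul ((hci i).const_mul 2)))).add
        (((hP₁ i).mul (hg₁n.mul ((hci i).const_mul 2))).add (hP.mul
          (((hg₂n.mul ((hci i).const_mul 2)).mul ((hci i).const_mul 2)).add
            (hg₁n.mul (((hci i).const_mul 0).add continuous_const))))))
      (fun i x => (hasLineDerivAt_eval p x i).mul_real (hasLineDerivAt_comp_norm_sq hg x i))
      (fun i x => by
        have hx : HasLineDerivAt ℝ (fun y : EuclideanSpace ℝ (Fin n) => 2 * y.ofLp i)
            (0 * x.ofLp i + 2 * 1) x (EuclideanSpace.single i 1) := by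
          have h2 : HasLineDerivAt ℝ (fun _ : EuclideanSpace ℝ (Fin n) => (2 : ℝ)) 0 x
            (EuclideanSpace.single i 1) := hasDerivAt_const (0 : ℝ) (2 : ℝ)
          simpa using h2.mul_real (hasLineDerivAt_coord x i i)
        exact ((hasLineDerivAt_eval _ x i).mul_real (hasLineDerivAt_comp_norm_sq hg x i)).add_real
          ((hasLineDerivAt_eval p x i).mul_real ((hasLineDerivAt_comp_norm_sq hg₁ x i).mul_real hx)))
      (fun x hx => by
        obtain ⟨z0, z1, z2⟩ := hgs _ hx
        exact ⟨by simp [z0], fun i => ⟨by simp [z0, z1], by simp [z0, z1, z2]⟩⟩)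
    have hpt : ∀ x : EuclideanSpace ℝ (Fin n), u x * ∑ i, (
        (MvPolynomial.eval x.ofLp (MvPolynomial.pderiv i (MvPolynomial.pderiv i p)) * g (‖x‖ ^ 2) +
          MvPolynomial.eval x.ofLp (MvPolynomial.pderiv i p) * (g₁ (‖x‖ ^ 2) * (2 * x.ofLp i))) +
        (MvPolynomial.eval x.ofLp (MvPolynomial.pderiv i p) * (g₁ (‖x‖ ^ 2) * (2 * x.ofLp i)) +
          MvPolynomial.eval x.ofLp p * (g₂ (‖x‖ ^ 2) * (2 * x.ofLp i) * (2 * x.ofLp i) +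
            g₁ (‖x‖ ^ 2) * (0 * x.ofLp i + 2 * 1)))) =
        ∑ i, u x * (MvPolynomial.eval x.ofLp (MvPolynomial.pderiv i (MvPolynomial.pderiv i p)) *
          g (‖x‖ ^ 2)) + (u x * (MvPolynomial.eval x.ofLp p * h (‖x‖ ^ 2)) +
            u x * (MvPolynomial.eval x.ofLp p * e (‖x‖ ^ 2))) := by
      intro x
      have euler : ∑ i, x.ofLp i * MvPolynomial.eval x.ofLp (MvPolynomial.pderiv i p) =
          k * MvPolynomial.eval x.ofLp p := by
        have := congrArg (MvPolynomial.eval x.ofLp) hp.sum_X_mul_pderiv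
        simpa using this
      have hn2 : ∑ i, x.ofLp i ^ 2 = ‖x‖ ^ 2 := (EuclideanSpace.real_norm_sq_eq x).symm
      rw [← Finset.mul_sum, ← mul_add, ← mul_add, ← mul_add, ← heq (‖x‖ ^ 2)]
      congr 1
      have e1 : ∀ i : Fin n,
          (MvPolynomial.eval x.ofLp (MvPolynomial.pderiv i (MvPolynomial.pderiv i p)) *
              g (‖x‖ ^ 2) +
            MvPolynomial.eval x.ofLp (MvPolynomial.pderiv i p) *
              (g₁ (‖x‖ ^ 2) * (2 * x.ofLp i))) +
          (MvPolynomial.eval x.ofLp (MvPolynomial.pderiv i p) *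
              (g₁ (‖x‖ ^ 2) * (2 * x.ofLp i)) +
            MvPolynomial.eval x.ofLp p * (g₂ (‖x‖ ^ 2) * (2 * x.ofLp i) * (2 * x.ofLp i) +
              g₁ (‖x‖ ^ 2) * (0 * x.ofLp i + 2 * 1))) =
          MvPolynomial.eval x.ofLp (MvPolynomial.pderiv i (MvPolynomial.pderiv i p)) *
              g (‖x‖ ^ 2) +
            4 * g₁ (‖x‖ ^ 2) * (x.ofLp i * MvPolynomial.eval x.ofLp (MvPolynomial.pderiv i p)) +
            MvPolynomial.eval x.ofLp p * 4 * g₂ (‖x‖ ^ 2) * x.ofLp i ^ 2 +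
            2 * MvPolynomial.eval x.ofLp p * g₁ (‖x‖ ^ 2) := fun i => by ring
      simp only [e1, Finset.sum_add_distrib, ← Finset.mul_sum, euler, hn2, Finset.sum_const,
        Finset.card_univ, Fintype.card_fin, nsmul_eq_mul]
      ring
    have hIg : ∀ i, Integrable fun x : EuclideanSpace ℝ (Fin n) =>
        u x * (MvPolynomial.eval x.ofLp (MvPolynomial.pderiv i (MvPolynomial.pderiv i p)) *
          g (‖x‖ ^ 2)) := fun i => hint _ g _ hgc fun s hsn => (hgs s hsn).1
    have hIh := hint p h b hc (hvan hs)
    have hIe := hint p e _ hec hes'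
    simp only [hpt] at green
    have hIs : Integrable fun x : EuclideanSpace ℝ (Fin n) => u x *
        (MvPolynomial.eval x.ofLp p * h (‖x‖ ^ 2)) + u x *
          (MvPolynomial.eval x.ofLp p * e (‖x‖ ^ 2)) := hIh.add hIe
    rw [integral_add (integrable_finsetSum _ fun i _ => hIg i) hIs,
      integral_add hIh hIe, integral_finsetSum _ fun i _ => hIg i,
      Finset.sum_eq_zero fun i _ => hdeg g (2 * (4 * r ^ 2)) hgc
        (fun s hsg => by_contra fun hsn => hsg (hgs s hsn).1) i, zero_add] at green
    rw [eq_neg_of_add_eq_zero_left green, enorm_neg]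
    refine (enorm_integral_le_lintegral_enorm _).trans ?_
    set S := {x : EuclideanSpace ℝ (Fin n) | 2 * r ≤ ‖x‖ ∧ ‖x‖ ≤ 3 * r} with hS
    have hSm : MeasurableSet S :=
      ((isClosed_le continuous_const continuous_norm).inter
        (isClosed_le continuous_norm continuous_const)).measurableSet
    rw [← mul_assoc, ← ENNReal.ofReal_mul (by positivity),
      ← lintegral_const_mul' _ _ ENNReal.ofReal_ne_top, ← lintegral_indicator hSm]
    refine lintegral_mono fun x => ?_
    by_cases hx : x ∈ S
    · rw [Set.indicator_of_mem hx, ← ENNReal.ofReal_mul (by positivity), ← ofReal_norm]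
      refine ENNReal.ofReal_le_ofReal ?_
      rw [Real.norm_eq_abs, abs_mul, abs_mul]
      have hx1 : 1 + ‖x‖ ≤ 4 * r := by linarith [hx.2]
      have h1 : |MvPolynomial.eval x.ofLp p| ≤ B * (4 * r) ^ m :=
        (hB x).trans (by gcongr)
      calc |u x| * (|MvPolynomial.eval x.ofLp p| * |e (‖x‖ ^ 2)|)
          ≤ |u x| * (B * (4 * r) ^ m * A) := by
            gcongr
            exact heA _
        _ = A * B * 4 ^ m * r ^ m * |u x| := by rw [mul_pow]; ring
    · rw [Set.indicator_of_notMem hx]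
      have : e (‖x‖ ^ 2) = 0 := by
        refine hvan hes _ fun hm => hx ⟨?_, ?_⟩
        · exact le_of_sq_le_sq (by linarith [hm.1]) (norm_nonneg x)
        · exact le_of_sq_le_sq (by nlinarith [hm.2]) (by positivity)
      simp [this]
  have hlim := ENNReal.Tendsto.const_mul (a := ENNReal.ofReal (A * B * 4 ^ m))
    (hV.tendsto_shell m) (Or.inr ENNReal.ofReal_ne_top)
  rw [mul_zero] at hlim
  -- The left side of `key` does not depend on `r`, and the right side tends to 0.
  have hle := ge_of_tendsto hlim (by
    filter_upwards [eventually_ge_atTop 1, eventually_ge_atTop a, eventually_ge_atTop b]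
      with r h1 h2 h3 using key r h1 h2 h3)
  simpa using hle

end Orthogonality

/-! ### Density of polynomials and vanishing of `u`. -/

section UniqueContinuation

variable {n : ℕ}

/-- Polynomials are uniformly dense in the continuous functions on a compact subset of `ℝⁿ`. -/
lemma exists_mvPolynomial_near {K : Set (EuclideanSpace ℝ (Fin n))} (hK : IsCompact K)
    {w : EuclideanSpace ℝ (Fin n) → ℝ} (hw : Continuous w) {ε : ℝ} (hε : 0 < ε) :
    ∃ p : MvPolynomial (Fin n) ℝ, ∀ x ∈ K, |MvPolynomial.eval x.ofLp p - w x| < ε := by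
  have : CompactSpace K := isCompact_iff_compactSpace.1 hK
  let X : Fin n → C(K, ℝ) := fun i => ⟨fun x => x.1.ofLp i, by fun_prop⟩
  have hX : ∀ (p : MvPolynomial (Fin n) ℝ) (x : K),
      MvPolynomial.aeval X p x = MvPolynomial.eval x.1.ofLp p := by
    intro p x
    induction p using MvPolynomial.induction_on with
    | C c => simp [algebraMap_apply]
    | add p q hp hq => simp [hp, hq]
    | mul_X p j hp => simp [hp, X]
  have hsep : (MvPolynomial.aeval (R := ℝ) X).range.SeparatesPoints := by
    intro x y hxy
    obtain ⟨i, hi⟩ : ∃ i, x.1.ofLp i ≠ y.1.ofLp i := by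
      by_contra! h
      exact hxy (Subtype.ext (PiLp.ext h))
    exact ⟨X i, ⟨X i, ⟨MvPolynomial.X i, by simp⟩, rfl⟩, hi⟩
  obtain ⟨⟨g, p, rfl⟩, hg⟩ :=
    ContinuousMap.exists_mem_subalgebra_near_continuous_of_separatesPoints
      (MvPolynomial.aeval (R := ℝ) X).range hsep (fun x : K => w x.1) (by fun_prop) ε hε
  exact ⟨p, fun x hx => by simpa [hX] using hg ⟨x, hx⟩⟩

/-- A continuous compactly supported function orthogonal to all polynomials vanishes. -/
lemma eq_zero_of_integral_mul_eval_eq_zero {w : EuclideanSpace ℝ (Fin n) → ℝ} (hw : Continuous w)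
    (hc : HasCompactSupport w)
    (h : ∀ p : MvPolynomial (Fin n) ℝ, ∫ x, w x * MvPolynomial.eval x.ofLp p = 0) : w = 0 := by
  have hwi : Integrable w := hw.integrable_of_hasCompactSupport hc
  have hI : ∀ {f : EuclideanSpace ℝ (Fin n) → ℝ}, Continuous f → Integrable fun x => w x * f x :=
    fun hf => (hw.mul hf).integrable_of_hasCompactSupport hc.mul_right
  set M := ∫ x, |w x| with hM
  have hM0 : 0 ≤ M := integral_nonneg fun _ => abs_nonneg _
  have hle : ∀ ε > 0, ∫ x, w x * w x ≤ ε * M := by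
    intro ε hε
    obtain ⟨p, hp⟩ := exists_mvPolynomial_near hc hw hε
    have hP : Continuous fun x : EuclideanSpace ℝ (Fin n) => MvPolynomial.eval x.ofLp p :=
      continuous_eval_euclidean p
    have : ∫ x, w x * w x = ∫ x, (w x * w x - w x * MvPolynomial.eval x.ofLp p) := by
      rw [integral_sub (hI hw) (hI hP), h p, sub_zero]
    rw [this, hM, ← integral_const_mul]
    refine integral_mono ((hI hw).sub (hI hP)) (hwi.abs.const_mul ε) fun x => ?_
    by_cases hx : x ∈ tsupport w
    · calc w x * w x - w x * MvPolynomial.eval x.ofLp p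
          = -(w x * (MvPolynomial.eval x.ofLp p - w x)) := by ring
        _ ≤ |w x * (MvPolynomial.eval x.ofLp p - w x)| := neg_le_abs _
        _ = |w x| * |MvPolynomial.eval x.ofLp p - w x| := abs_mul _ _
        _ ≤ |w x| * ε := mul_le_mul_of_nonneg_left (hp x hx).le (abs_nonneg _)
        _ = ε * |w x| := mul_comm _ _
    · simp [image_eq_zero_of_notMem_tsupport hx]
  have h0 : ∫ x, w x * w x = 0 := by
    refine le_antisymm ?_ (integral_nonneg fun x => mul_self_nonneg _)
    refine le_of_forall_pos_le_add fun ε hε => ?_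
    -- Dividing by `M + 1` rather than `M` allows `M = 0`.
    have h1 := hle (ε / (M + 1)) (by positivity)
    have h2 : ε / (M + 1) * M ≤ ε := by
      rw [div_mul_eq_mul_div, div_le_iff₀ (by positivity)]
      nlinarith
    linarith
  have h1 := (integral_eq_zero_iff_of_nonneg (fun x => mul_self_nonneg (w x)) (hI hw)).1 h0
  have h2 := (Continuous.ae_eq_iff_eq volume (hw.mul hw) continuous_const).1 h1
  funext x
  exact mul_self_eq_zero.1 (congrFun h2 x)

/-- A harmonic function on the exterior of a ball which vanishes to infinite order at infinity
is identically zero. -/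
theorem eq_zero_of_vanishesToInfiniteOrderAtInfinity {r₀ : ℝ} (hr₀ : 0 < r₀)
    {u : EuclideanSpace ℝ (Fin n) → ℝ} (hu : HarmonicOnNhd u {x | r₀ < ‖x‖})
    (hV : VanishesToInfiniteOrderAtInfinity u) {x₀ : EuclideanSpace ℝ (Fin n)}
    (hx₀ : r₀ < ‖x₀‖) : u x₀ = 0 := by
  have hsq : r₀ ^ 2 < ‖x₀‖ ^ 2 := by gcongr
  obtain ⟨a, ha, hax⟩ := exists_between hsq
  set s₀ := ‖x₀‖ ^ 2 with hs₀
  -- A tent centred at `s₀` with half-width and height `s₀ - a`: positive at `s₀`, supported in [a,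
  -- 2s₀ - a].
  set h : ℝ → ℝ := fun s => max 0 (s₀ - a - |s - s₀|) with hh
  have hc : Continuous h := by fun_prop
  have hs : Function.support h ⊆ Set.Icc a (2 * s₀ - a) := by
    intro s hs
    have : 0 < s₀ - a - |s - s₀| := by
      by_contra! hle
      exact hs (max_eq_left hle)
    obtain ⟨h1, h2⟩ := abs_lt.1 (show |s - s₀| < s₀ - a by linarith)
    exact ⟨by linarith, by linarith⟩
  have hucont : ContinuousOn u {x | r₀ < ‖x‖} := hu.contDiffOn.continuousOn
  have hvan : ∀ x : EuclideanSpace ℝ (Fin n), ‖x‖ ^ 2 ∉ Set.Icc a (2 * s₀ - a) →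
      u x * h (‖x‖ ^ 2) = 0 := fun x hx => by
    rw [show h (‖x‖ ^ 2) = 0 from by_contra fun hne => hx (hs hne), mul_zero]
  have hhn : Continuous fun x : EuclideanSpace ℝ (Fin n) => h (‖x‖ ^ 2) := by fun_prop
  have hwc : Continuous fun x => u x * h (‖x‖ ^ 2) :=
    continuous_of_annulus ha (hucont.mul hhn.continuousOn) hvan
  have hws : HasCompactSupport fun x => u x * h (‖x‖ ^ 2) := hasCompactSupport_of_annulus hvan
  have hw := eq_zero_of_integral_mul_eval_eq_zero hwc hws fun p => by
    have hint : ∀ q : MvPolynomial (Fin n) ℝ, Integrable fun x : EuclideanSpace ℝ (Fin n) =>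
        u x * h (‖x‖ ^ 2) * MvPolynomial.eval x.ofLp q := fun q =>
      (hwc.mul (continuous_eval_euclidean q)).integrable_of_hasCompactSupport hws.mul_right
    rw [← p.sum_homogeneousComponent]
    simp only [map_sum, Finset.mul_sum]
    rw [integral_finsetSum _ fun k _ => hint _]
    refine Finset.sum_eq_zero fun k _ => ?_
    rw [← integral_mul_homogeneous_mul_radial_eq_zero hr₀ ha hu hV k _
      (MvPolynomial.homogeneousComponent_isHomogeneous k p) _ h hc hs]
    congr 1 with x
    ring
  have h1 : u x₀ * h s₀ = 0 := congrFun hw x₀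
  have h2 : 0 < h s₀ := by simp [hh, hax]
  exact (mul_eq_zero.1 h1).resolve_right h2.ne'

/-- If `u` does not vanish to infinite order at infinity, then some polynomial weight makes its
tail integral unbounded. -/
lemma exists_limsup_eq_top_of_not_vanishes {u : EuclideanSpace ℝ (Fin n) → ℝ}
    (hV : ¬ VanishesToInfiniteOrderAtInfinity u) :
    ∃ N : ℝ, 0 ≤ N ∧
      limsup (fun r : ℝ => ENNReal.ofReal (r ^ N) * tailL2 u r) atTop = ∞ := by
  simp only [VanishesToInfiniteOrderAtInfinity, not_forall] at hV
  obtain ⟨m, hm, hnot⟩ := hV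
  -- If r^m times the tail exceeds a fixed c > 0 for arbitrarily large `r`, the extra factor `r`
  -- makes these values unbounded.
  refine ⟨m + 1, by linarith, ?_⟩
  have hfreq : ∃ c : ℝ≥0∞, c ≠ 0 ∧
      ∃ᶠ r : ℝ in atTop, c < ENNReal.ofReal (r ^ m) * tailL2 u r := by
    by_contra! hcon
    refine hnot (ENNReal.tendsto_nhds_zero.2 fun ε hε => ?_)
    filter_upwards [hcon ε hε.ne'] with r hr using hr
  obtain ⟨c, hc0, hc⟩ := hfreq
  have hlin : Tendsto (fun r : ℝ => ENNReal.ofReal r * c) atTop (𝓝 ∞) := by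
    have := ENNReal.Tendsto.mul_const (b := c) ENNReal.tendsto_ofReal_atTop 
      (Or.inl ENNReal.top_ne_zero)
    rwa [ENNReal.top_mul hc0] at this
  refine top_le_iff.1 (le_of_forall_lt fun M hM => ?_)
  obtain ⟨M', hMM', hM'⟩ := exists_between hM
  refine hMM'.trans_le (le_limsup_of_frequently_le ?_ (by isBoundedDefault))
  refine (hc.and_eventually ((hlin.eventually (lt_mem_nhds hM')).and
    (eventually_gt_atTop 0))).mono ?_
  rintro r ⟨h1, h2, hr⟩
  rw [Real.rpow_add_one hr.ne', mul_comm (r ^ m), ENNReal.ofReal_mul hr.le, mul_assoc]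
  exact h2.le.trans (mul_le_mul_right h1.le _)

end UniqueContinuation

/-! ### Both claims, with the boundary sphere included. -/

theorem corollary3p7 (n : ℕ) (hn : 1 ≤ n) (r₀ : ℝ) (hr₀ : 0 < r₀)
    (u : EuclideanSpace ℝ (Fin n) → ℝ)
    (hcont : ContinuousOn u {x | r₀ ≤ ‖x‖})
    (hharm : HarmonicOnNhd u {x | r₀ < ‖x‖}) :
    (VanishesToInfiniteOrderAtInfinity u → ∀ x, r₀ ≤ ‖x‖ → u x = 0) ∧
    ((∃ x, r₀ ≤ ‖x‖ ∧ u x ≠ 0) →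
      ∃ N : ℝ, 0 ≤ N ∧
        limsup (fun r : ℝ => ENNReal.ofReal (r ^ N) * tailL2 u r) atTop = ∞) := by
  have main : VanishesToInfiniteOrderAtInfinity u → ∀ x, r₀ ≤ ‖x‖ → u x = 0 := by
    intro hV x hx
    have hmem : ∀ t : ℝ, 1 < t → r₀ < ‖t • x‖ := fun t ht => by
      rw [norm_smul, Real.norm_of_nonneg (by linarith)]
      nlinarith
    -- On the sphere itself, `u x` is the limit of `u (t • x)` as t decreases to 1, along points
    -- strictly outside the ball.
    have hpath : Tendsto (fun t : ℝ => t • x) (𝓝[>] 1) (𝓝[{x | r₀ ≤ ‖x‖}] x) := by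
      refine tendsto_nhdsWithin_iff.2 ⟨?_, ?_⟩
      · have : Continuous fun t : ℝ => t • x := by fun_prop
        simpa using (this.tendsto 1).mono_left nhdsWithin_le_nhds
      · filter_upwards [self_mem_nhdsWithin] with t ht using (hmem t ht).le
    have hlim : Tendsto (fun t : ℝ => u (t • x)) (𝓝[>] 1) (𝓝 (u x)) :=
      (hcont x hx).tendsto.comp hpath
    refine tendsto_nhds_unique hlim (tendsto_const_nhds.congr' ?_)
    filter_upwards [self_mem_nhdsWithin] with t ht
    exact (eq_zero_of_vanishesToInfiniteOrderAtInfinity hr₀ hharm hV (hmem t ht)).symm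
  refine ⟨main, ?_⟩
  rintro ⟨x, hx, hux⟩
  exact exists_limsup_eq_top_of_not_vanishes fun hV => hux (main hV x hx)
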